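/- Let $n$ be a positive integer and let $\mathrm{UT}_n(\mathbb{Z})$ be the group of all lower unitriangular $n\times n$ integer matrices (ones on the diagonal, zeros above it) under matrix multiplication. Call an automorphism $\varphi$ of a group $G$ class preserving if $\varphi(x)$ is conjugate to $x$ in $G$ for every $x\in G$; the class preserving automorphisms form a subgroup $\operatorname{Aut}_c(G)$ of $\operatorname{Aut}(G)$, which contains the group $\operatorname{Inn}(G)$ of inner automorphisms. Then $$\operatorname{Aut}_c(\mathrm{UT}_n(\mathbb{Z}))=\operatorname{Inn}(\mathrm{UT}_n(\mathbb{Z})).$$ -/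

import Mathlib

/-- The group of lower unitriangular `n × n` matrices over a commutative ring `R`: ones on the
diagonal, zeros strictly above it. It is realized inside the group of invertible matrices. -/
def UT (n : ℕ) (R : Type*) [CommRing R] : Subgroup (GL (Fin n) R) where
  carrier := {g | (∀ i, g.val i i = 1) ∧ ∀ i j, i < j → g.val i j = 0}
  one_mem' := ⟨fun i => by simp, fun i j h => by simp [h.ne]⟩
  mul_mem' := by
    rintro a b ⟨ha, ha'⟩ ⟨hb, hb'⟩
    refine ⟨fun i => ?_, fun i j hij => ?_⟩
    · rw [Units.val_mul, Matrix.mul_apply, Finset.sum_eq_single i]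
      · rw [ha, hb, one_mul]
      · intro k _ hk
        rcases lt_or_gt_of_ne hk with h | h
        · rw [hb' k i h, mul_zero]
        · rw [ha' i k h, zero_mul]
      · simp
    · rw [Units.val_mul, Matrix.mul_apply]
      refine Finset.sum_eq_zero fun k _ => ?_
      rcases lt_or_ge i k with h | h
      · rw [ha' i k h, zero_mul]
      · rw [hb' k j (h.trans_lt hij), mul_zero]
  inv_mem' := by
    rintro a ⟨ha, ha'⟩
    have hT : a.val.IsLowerTriangular := fun i j h => ha' i j h
    letI : Invertible a.val := a.invertible
    have hU : ∀ i j, i < j → (a⁻¹).val i j = 0 := fun i j h => by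
      rw [Matrix.coe_units_inv]
      exact Matrix.blockTriangular_inv_of_blockTriangular hT h
    refine ⟨fun i => ?_, hU⟩
    have h1 : (a.val * (a⁻¹).val) i i = 1 := by
      rw [Units.mul_inv, Matrix.one_apply_eq]
    rw [Matrix.mul_apply, Finset.sum_eq_single i, ha, one_mul] at h1
    · exact h1
    · intro k _ hk
      rcases lt_or_gt_of_ne hk with h | h
      · rw [hU k i h, mul_zero]
      · rw [ha' i k h, zero_mul]
    · simp

/-- The set of class preserving automorphisms `φ` of a group `G`, those with `φ x ∈ x ^ G` for
all `x`, as a subgroup of the automorphism group. -/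
def classPreservingAut (G : Type*) [Group G] : Subgroup (MulAut G) where
  carrier := {φ | ∀ x : G, φ x ∈ conjugatesOf x}
  one_mem' := fun _ => mem_conjugatesOf_self
  mul_mem' := fun {φ ψ} hφ hψ x => IsConj.trans (hψ x) (hφ (ψ x))
  inv_mem' := fun {φ} hφ x => by
    have h : IsConj (φ⁻¹ x) (φ (φ⁻¹ x)) := hφ (φ⁻¹ x)
    rw [MulAut.apply_inv_self] at h
    exact h.symm

/-- The group of inner automorphisms of a group `G`. -/
def innerAut (G : Type*) [Group G] : Subgroup (MulAut G) :=
  (MulAut.conj : G →* MulAut G).range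

open Matrix

/-! Induct on the size, writing `UT (n + 1)` as a semidirect product of `UT n` with row vectors (`mk
C w`). Over ℤ the simple transvections generate, so a class preserving endomorphism f need only be
matched with a conjugation on them. On the top left block f induces a class preserving endomorphism,
inner by induction; after a correction by `topLeft`, f fixes the top left blocks of all simple
transvections but the last. Commutation relations then force the last one to move only by a corner
entry, which a central element of the block removes. What remains adds to the last row of each other
generator a multiple of one unit row (`exists_eq_mk_single_of_isConj`), and one conjugation by some
`mk 1 w` produces all these multiples at once. -/

namespace UT

variable {R : Type*} [CommRing R] {n : ℕ}

/-- The underlying matrix of a unitriangular group element. -/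
def mat (g : UT n R) : Matrix (Fin n) (Fin n) R := g.1.1

theorem mat_injective : Function.Injective (mat : UT n R → Matrix (Fin n) (Fin n) R) :=
  fun _ _ h => Subtype.ext (Units.ext h)

@[simp] theorem mat_mul (g h : UT n R) : mat (g * h) = mat g * mat h := rfl

@[simp] theorem mat_one : mat (1 : UT n R) = 1 := rfl

@[simp] theorem mat_diag (g : UT n R) (i : Fin n) : mat g i i = 1 := g.2.1 i

theorem mat_upper (g : UT n R) {i j : Fin n} (h : i < j) : mat g i j = 0 := g.2.2 i j h

/-- The unitriangular group element with a given underlying matrix. -/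
noncomputable def ofMatrix (M : Matrix (Fin n) (Fin n) R) (hd : ∀ i, M i i = 1)
    (hu : ∀ i j, i < j → M i j = 0) : UT n R :=
  ⟨GeneralLinearGroup.mk'' M (by
    have h : M.IsLowerTriangular := fun i j h => hu i j h
    rw [Matrix.det_of_isLowerTriangular _ h]
    simp [hd]), hd, hu⟩

@[simp] theorem mat_ofMatrix (M : Matrix (Fin n) (Fin n) R) (hd hu) :
    mat (ofMatrix M hd hu) = M := rfl

/-! ### Block decomposition -/

/-- The unitriangular matrix with top left block `C` and last row `(w, 1)`. -/
noncomputable def mk (C : UT n R) (w : Fin n → R) : UT (n + 1) R :=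
  ofMatrix (of fun i j => Fin.lastCases (Fin.lastCases 1 w j)
      (fun i' => Fin.lastCases 0 (mat C i') j) i)
    (fun i => by cases i using Fin.lastCases <;> simp)
    (fun i j h => by
      cases i using Fin.lastCases with
      | last => exact absurd h (not_lt.2 (Fin.le_last j))
      | cast i =>
        cases j using Fin.lastCases with
        | last => simp
        | cast j => simpa using mat_upper C (by simpa using h))

@[simp] theorem mat_mk_castSucc (C : UT n R) (w : Fin n → R) (i j : Fin n) :
    mat (mk C w) i.castSucc j.castSucc = mat C i j := by simp [mk]

@[simp] theorem mat_mk_last (C : UT n R) (w : Fin n → R) (j : Fin n) :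
    mat (mk C w) (Fin.last n) j.castSucc = w j := by simp [mk]

@[simp] theorem mat_mk_castSucc_last (C : UT n R) (w : Fin n → R) (i : Fin n) :
    mat (mk C w) i.castSucc (Fin.last n) = 0 := by simp [mk]

theorem mk_mul (C D : UT n R) (w v : Fin n → R) :
    mk C w * mk D v = mk (C * D) (w ᵥ* mat D + v) := by
  apply mat_injective
  ext i j
  rw [mat_mul, mul_apply, Fin.sum_univ_castSucc]
  cases i using Fin.lastCases <;> cases j using Fin.lastCases <;>
    simp [mul_apply, vecMul, dotProduct]

theorem mk_inj {C D : UT n R} {w v : Fin n → R} : mk C w = mk D v ↔ C = D ∧ w = v := by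
  refine ⟨fun h => ⟨mat_injective ?_, ?_⟩, fun h => by rw [h.1, h.2]⟩
  · ext i j
    rw [← mat_mk_castSucc C w, h, mat_mk_castSucc]
  · ext j
    rw [← mat_mk_last C w, h, mat_mk_last]

theorem mk_one_zero : mk (1 : UT n R) 0 = 1 := by
  have h := mk_mul (1 : UT n R) 1 0 0
  rw [zero_vecMul, add_zero, mul_one] at h
  exact mul_eq_left.1 h

theorem exists_eq_mk (g : UT (n + 1) R) : ∃ C w, g = mk C w := by
  refine ⟨ofMatrix ((mat g).submatrix Fin.castSucc Fin.castSucc) (fun i => by simp)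
    (fun i j h => mat_upper g (by simpa using h)), fun j => mat g (Fin.last n) j.castSucc,
    mat_injective ?_⟩
  ext i j
  cases i using Fin.lastCases with
  | last => cases j using Fin.lastCases <;> simp
  | cast i =>
    cases j using Fin.lastCases with
    | last => simpa using mat_upper g (Fin.castSucc_lt_last i)
    | cast j => rw [mat_mk_castSucc]; rfl

/-- The embedding of `UT n R` in `UT (n + 1) R` as top left block. -/
noncomputable def topLeft : UT n R →* UT (n + 1) R where
  toFun C := mk C 0
  map_one' := mk_one_zero
  map_mul' C D := by rw [mk_mul, zero_vecMul, zero_add]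

theorem topLeft_apply (C : UT n R) : topLeft C = mk C 0 := rfl

/-- The projection of `UT (n + 1) R` on the top left block. -/
noncomputable def proj : UT (n + 1) R →* UT n R :=
  MonoidHom.mk' (fun g => (exists_eq_mk g).choose) (fun g h => by
    obtain ⟨w, hw⟩ := (exists_eq_mk g).choose_spec
    obtain ⟨v, hv⟩ := (exists_eq_mk h).choose_spec
    obtain ⟨u, hu⟩ := (exists_eq_mk (g * h)).choose_spec
    have key := congrArg₂ (· * ·) hw hv
    simp only [mk_mul] at key
    exact (mk_inj.1 (hu.symm.trans key)).1)

@[simp] theorem proj_mk (C : UT n R) (w : Fin n → R) : proj (mk C w) = C := by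
  obtain ⟨v, hv⟩ := (exists_eq_mk (mk C w)).choose_spec
  exact (mk_inj.1 hv).1.symm

theorem exists_eq_mk_proj (g : UT (n + 1) R) : ∃ w, g = mk (proj g) w := by
  obtain ⟨C, w, rfl⟩ := exists_eq_mk g
  exact ⟨w, by rw [proj_mk]⟩

/-! ### Generation by simple transvections -/

/-- The simple transvections `1 + E_{i+1,i}`. -/
noncomputable def simple (i : Fin n) : UT (n + 1) R :=
  ofMatrix (1 + Matrix.single i.succ i.castSucc 1)
    (fun j => by
      have : ¬ (i.succ = j ∧ i.castSucc = j) := fun h =>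
        (Fin.castSucc_lt_succ (i := i)).ne (h.2.trans h.1.symm)
      simp [this])
    (fun j k h => by
      have : ¬ (i.succ = j ∧ i.castSucc = k) := by
        rintro ⟨rfl, rfl⟩
        exact absurd h (Fin.castSucc_lt_succ (i := i)).asymm
      simp [this, Matrix.one_apply_ne h.ne])

theorem mat_simple (i : Fin n) :
    mat (simple i : UT (n + 1) R) = 1 + Matrix.single i.succ i.castSucc 1 := rfl

theorem vecMul_simple (v : Fin (n + 1) → R) (i : Fin n) :
    v ᵥ* mat (simple i) = v + Pi.single i.castSucc (v i.succ) := by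
  rw [mat_simple, vecMul_add, vecMul_one]
  congr 1
  ext j
  simp only [vecMul, dotProduct, Matrix.single_apply, Pi.single_apply]
  rw [Finset.sum_eq_single i.succ] <;> simp +contextual [eq_comm]

theorem simple_castSucc (i : Fin n) :
    (simple i.castSucc : UT (n + 2) R) = mk (simple i) 0 := by
  apply mat_injective
  ext j k
  cases j using Fin.lastCases <;> cases k using Fin.lastCases <;>
    simp [mat_simple, Matrix.single_apply, Matrix.one_apply, Fin.ext_iff] <;>
    rw [if_neg (by omega), if_neg (by omega), add_zero]

theorem simple_last :
    (simple (Fin.last n) : UT (n + 2) R) = mk 1 (Pi.single (Fin.last n) 1) := by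
  apply mat_injective
  ext j k
  cases j using Fin.lastCases <;> cases k using Fin.lastCases <;>
    simp [mat_simple, Matrix.single_apply, Matrix.one_apply, Pi.single_apply, Fin.ext_iff] <;> grind

theorem vecMul_mat_last (v : Fin (n + 1) → R) (D : UT (n + 1) R) :
    (v ᵥ* mat D) (Fin.last n) = v (Fin.last n) := by
  rw [vecMul, dotProduct, Finset.sum_eq_single (Fin.last n)]
  · simp
  · intro i _ hi
    rw [mat_upper D (Fin.lt_last_iff_ne_last.2 hi), mul_zero]
  · simp

theorem last_vecMul_mk (w : Fin n → R) (C : UT n R) :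
    Pi.single (Fin.last n) 1 ᵥ* mat (mk C w) = Fin.snoc w 1 := by
  ext j
  cases j using Fin.lastCases <;> simp

/-- Conjugating the last simple transvection by the top left block reaches every last row whose
final entry is 1; its integer powers then adjust that entry. -/
theorem mk_one_mem_closure_simple (v : Fin (n + 1) → ℤ)
    (h : ∀ C : UT (n + 1) ℤ, topLeft C ∈ Subgroup.closure (Set.range (simple (R := ℤ)))) :
    mk 1 v ∈ Subgroup.closure (Set.range (simple (R := ℤ) (n := n + 1))) := by
  set H := Subgroup.closure (Set.range (simple (R := ℤ) (n := n + 1)))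
  have hlast : mk 1 (Pi.single (Fin.last n) 1) ∈ H :=
    simple_last (R := ℤ) (n := n) ▸ Subgroup.subset_closure (Set.mem_range_self _)
  have hone (w : Fin n → ℤ) : mk 1 (Fin.snoc w 1) ∈ H := by
    have key : (topLeft (mk 1 w))⁻¹ * mk 1 (Pi.single (Fin.last n) 1) * topLeft (mk 1 w) =
        mk 1 (Fin.snoc w 1 : Fin (n + 1) → ℤ) := by
      rw [mul_assoc, inv_mul_eq_iff_eq_mul, topLeft_apply, mk_mul, mk_mul, last_vecMul_mk]
      simp
    exact key ▸ H.mul_mem (H.mul_mem (H.inv_mem (h _)) hlast) (h _)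
  have hpow (k : ℤ) : mk 1 (Pi.single (Fin.last n) k) ∈ H := by
    let F : Multiplicative ℤ →* UT (n + 2) ℤ :=
      MonoidHom.mk' (fun k => mk 1 (Pi.single (Fin.last n) k.toAdd)) (fun a b => by
        simp [mk_mul, Pi.single_add])
    have := H.zpow_mem hlast k
    have e : F (Multiplicative.ofAdd 1 ^ k) = F (Multiplicative.ofAdd 1) ^ k := map_zpow _ _ _
    rw [← ofAdd_zsmul, smul_eq_mul, mul_one] at e
    rw [← show F (Multiplicative.ofAdd 1) = mk 1 (Pi.single (Fin.last n) 1) from rfl, ← e] at this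
    exact this
  have hsum := H.mul_mem (hone (Fin.init v)) (hpow (v (Fin.last n) - 1))
  rw [mk_mul] at hsum
  convert hsum using 2
  · simp
  · ext j
    cases j using Fin.lastCases <;> simp [Fin.init]

/-- The simple transvections generate the integral unitriangular group. -/
theorem closure_range_simple :
    Subgroup.closure (Set.range (simple (R := ℤ) (n := n))) = ⊤ := by
  induction n with
  | zero =>
    refine (Subgroup.eq_top_iff' _).2 fun g => ?_
    have : g = 1 := mat_injective (by ext i j; fin_cases i; fin_cases j; simp)
    exact this ▸ one_mem _
  | succ n ih =>
    have h (C : UT (n + 1) ℤ) : topLeft C ∈ Subgroup.closure (Set.range (simple (R := ℤ))) := by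
      have hle : Subgroup.closure (Set.range (simple (R := ℤ) (n := n))) ≤
          (Subgroup.closure (Set.range (simple (R := ℤ) (n := n + 1)))).comap topLeft := by
        rw [Subgroup.closure_le]
        rintro _ ⟨i, rfl⟩
        exact Subgroup.subset_closure ⟨i.castSucc, simple_castSucc i⟩
      exact hle (ih ▸ Subgroup.mem_top C)
    refine (Subgroup.eq_top_iff' _).2 fun g => ?_
    obtain ⟨C, w, rfl⟩ := exists_eq_mk g
    have key : mk C w = topLeft C * mk 1 w := by simp [topLeft_apply, mk_mul]
    exact key ▸ mul_mem (h C) (mk_one_mem_closure_simple w h)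

/-! ### Class preserving endomorphisms -/

theorem eq_and_vecMul_eq_of_isConj {B C : UT n R} {u v : Fin n → R}
    (h : IsConj (mk B u) (mk C v)) :
    ∃ D w, D * B = C * D ∧ w ᵥ* mat B + u = v ᵥ* mat D + w := by
  obtain ⟨c, hc⟩ := h
  obtain ⟨D, w, hD⟩ := exists_eq_mk (c : UT (n + 1) R)
  rw [SemiconjBy, hD, mk_mul, mk_mul, mk_inj] at hc
  exact ⟨D, w, hc⟩

/-- A conjugate of `mk (simple i) 0` with the same top left block has last row a multiple of the
`i`-th unit row. -/
theorem exists_eq_mk_single_of_isConj {i : Fin n} {v : Fin (n + 1) → R}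
    (h : IsConj (mk (simple i) 0) (mk (simple i) v)) : ∃ d, v = Pi.single i.castSucc d := by
  obtain ⟨D, w, hD, hw⟩ := eq_and_vecMul_eq_of_isConj h
  -- Equal blocks force `D` to centralize `simple i`, so `w ᵥ* mat D⁻¹` can play the role of `w`.
  have hD' : simple i * D⁻¹ = D⁻¹ * simple i := by
    rw [eq_inv_mul_iff_mul_eq, ← mul_assoc, hD, mul_inv_cancel_right]
  refine ⟨(w ᵥ* mat D⁻¹) i.succ, ?_⟩
  have h2 := congrArg (· ᵥ* mat D⁻¹) hw
  simp only [add_zero, add_vecMul, vecMul_vecMul, ← mat_mul, mul_inv_cancel, mat_one, vecMul_one,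
    hD'] at h2
  rw [mat_mul, ← vecMul_vecMul, vecMul_simple, add_comm (w ᵥ* _)] at h2
  exact (add_right_cancel h2).symm

theorem isConj_conj_comp_apply {G : Type*} [Group G] {f : G →* G} (hf : ∀ x, IsConj x (f x)) (g x : G) :
    IsConj x ((MulAut.conj g).toMonoidHom.comp f x) :=
  (hf x).trans (isConj_iff.2 ⟨g, rfl⟩)

theorem exists_eq_conj_of_conj_comp {G : Type*} [Group G] {f : G →* G} {g : G}
    (h : ∃ k, (MulAut.conj g).toMonoidHom.comp f = (MulAut.conj k).toMonoidHom) :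
    ∃ k, f = (MulAut.conj k).toMonoidHom := by
  obtain ⟨k, hk⟩ := h
  refine ⟨g⁻¹ * k, MonoidHom.ext fun x => ?_⟩
  have := DFunLike.congr_fun hk x
  simp only [MonoidHom.comp_apply, MulEquiv.coe_toMonoidHom, MulAut.conj_apply] at this ⊢
  rw [mul_inv_eq_iff_eq_mul, ← eq_inv_mul_iff_mul_eq] at this
  rw [this]
  group

/-- A class preserving endomorphism that fixes the last simple transvection and the top left
blocks of the others is inner. -/
theorem exists_eq_conj_of_simple {f : UT (n + 2) ℤ →* UT (n + 2) ℤ} (hf : ∀ x, IsConj x (f x))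
    (hproj : ∀ i : Fin n, proj (f (simple i.castSucc)) = simple i)
    (hlast : f (simple (Fin.last n)) = simple (Fin.last n)) :
    ∃ k, f = (MulAut.conj k).toMonoidHom := by
  have h (i : Fin n) : ∃ d : ℤ, f (simple i.castSucc) = mk (simple i) (Pi.single i.castSucc d) := by
    obtain ⟨v, hv⟩ := exists_eq_mk_proj (f (simple i.castSucc))
    rw [hproj] at hv
    have hc := hf (simple i.castSucc)
    rw [hv, simple_castSucc] at hc
    obtain ⟨d, rfl⟩ := exists_eq_mk_single_of_isConj hc
    exact ⟨d, hv⟩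
  choose d hd using h
  -- Conjugating generator `i` by `mk 1 w` adds `w i.succ` at position `i.castSucc`, so `w i.succ =
  -- d i`; entry 0 is free.
  refine ⟨mk 1 (Fin.cons 0 d), MonoidHom.eq_of_eqOn_top ?_⟩
  rw [← closure_range_simple]
  refine MonoidHom.eqOn_closure ?_
  rintro _ ⟨i, rfl⟩
  rw [MulEquiv.coe_toMonoidHom, MulAut.conj_apply, eq_mul_inv_iff_mul_eq]
  cases i using Fin.lastCases with
  | last => rw [hlast, simple_last, mk_mul, mk_mul]; simp [add_comm]
  | cast i => rw [hd, simple_castSucc, mk_mul, mk_mul, vecMul_simple]; simp [add_comm]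

/-- The hypotheses leave only the first and last entries of `v`, so a corner entry suffices for `Z`,
and corner transvections are central. -/
theorem exists_commute_simple {v : Fin (n + 1) → R} (hlast : v (Fin.last n) = 1)
    (h : ∀ i : Fin n, i.succ ≠ Fin.last n → v i.succ = 0) :
    ∃ Z : UT (n + 1) R, Pi.single (Fin.last n) 1 ᵥ* mat Z = v ∧
      ∀ i, Commute Z (simple i) := by
  refine ⟨mk 1 (Fin.init v), ?_, fun i => ?_⟩
  · rw [last_vecMul_mk, ← hlast, Fin.snoc_init_self]
  · cases n with
    | zero => exact i.elim0
    | succ n =>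
      cases i using Fin.lastCases with
      | last => rw [Commute, SemiconjBy, simple_last, mk_mul, mk_mul]; simp [add_comm]
      | cast i =>
        rw [Commute, SemiconjBy, simple_castSucc, mk_mul, mk_mul, vecMul_simple]
        have : Fin.init v i.succ = 0 := by
          simpa [Fin.init] using h i.castSucc (by simp [Fin.ext_iff]; omega)
        simp [this]

/-- A class preserving endomorphism that fixes the top left blocks of the simple transvections
is inner. -/
theorem exists_eq_conj_of_proj_simple {f : UT (n + 2) ℤ →* UT (n + 2) ℤ}
    (hf : ∀ x, IsConj x (f x))
    (hproj : ∀ i : Fin n, proj (f (simple i.castSucc)) = simple i) :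
    ∃ k, f = (MulAut.conj k).toMonoidHom := by
  obtain ⟨B, v, hv⟩ := exists_eq_mk (f (simple (Fin.last n)))
  have hc := hf (simple (Fin.last n))
  rw [hv, simple_last] at hc
  obtain ⟨D, w, hD, hw⟩ := eq_and_vecMul_eq_of_isConj hc
  rw [mul_one] at hD
  obtain rfl : B = 1 := right_eq_mul.1 hD
  rw [mat_one, vecMul_one, add_comm w] at hw
  have hvlast : v (Fin.last n) = 1 := by
    rw [← vecMul_mat_last v D, ← add_right_cancel hw, Pi.single_eq_same]
  -- `f` preserves the commutation of the last generator with the nonadjacent ones; entry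
  -- `i.castSucc` of the last row gives the vanishing.
  have hcomm (i : Fin n) (hi : i.succ ≠ Fin.last n) : v i.succ = 0 := by
    have h1 : Commute (simple (Fin.last n) : UT (n + 2) ℤ) (simple i.castSucc) := by
      rw [Commute, SemiconjBy, simple_castSucc, simple_last, mk_mul, mk_mul, vecMul_simple]
      simp [Pi.single_eq_of_ne hi]
    have h2 := h1.map f
    obtain ⟨u, hu⟩ := exists_eq_mk_proj (f (simple i.castSucc))
    rw [hproj] at hu
    rw [hv, hu, Commute, SemiconjBy, mk_mul, mk_mul, mk_inj, vecMul_simple] at h2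
    have h3 := congrFun h2.2 i.castSucc
    simp at h3
    linarith
  obtain ⟨Z, hZ, hZc⟩ := exists_commute_simple hvlast hcomm
  refine exists_eq_conj_of_conj_comp (g := topLeft Z) (exists_eq_conj_of_simple
    (isConj_conj_comp_apply hf _) (fun i => ?_) ?_)
  · simp only [MonoidHom.comp_apply, MulEquiv.coe_toMonoidHom, MulAut.conj_apply, map_mul, map_inv,
      hproj, topLeft_apply, proj_mk]
    rw [(hZc i).eq, mul_inv_cancel_right]
  · simp only [MonoidHom.comp_apply, MulEquiv.coe_toMonoidHom, MulAut.conj_apply]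
    rw [mul_inv_eq_iff_eq_mul, hv, simple_last, topLeft_apply, mk_mul, mk_mul, hZ]
    simp

/-- Every class preserving endomorphism of the integral unitriangular group is inner. -/
theorem exists_eq_conj_of_isConj (f : UT (n + 1) ℤ →* UT (n + 1) ℤ) (hf : ∀ x, IsConj x (f x)) :
    ∃ k, f = (MulAut.conj k).toMonoidHom := by
  induction n with
  | zero =>
    refine ⟨1, MonoidHom.eq_of_eqOn_top ?_⟩
    rw [← closure_range_simple]
    refine MonoidHom.eqOn_closure ?_
    rintro _ ⟨i, rfl⟩
    exact i.elim0
  | succ n ih =>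
    obtain ⟨C, hC⟩ := ih (proj.comp (f.comp topLeft)) fun x => by
      have h := (proj (R := ℤ) (n := n + 1)).map_isConj (hf (topLeft x))
      rwa [topLeft_apply, proj_mk] at h
    refine exists_eq_conj_of_conj_comp (g := (topLeft C)⁻¹) (exists_eq_conj_of_proj_simple
      (isConj_conj_comp_apply hf _) fun i => ?_)
    have h := DFunLike.congr_fun hC (simple i)
    simp only [MonoidHom.comp_apply, MulEquiv.coe_toMonoidHom, MulAut.conj_apply,
      topLeft_apply] at h
    simp only [MonoidHom.comp_apply, MulEquiv.coe_toMonoidHom, MulAut.conj_apply, map_mul,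
      simple_castSucc, h, proj.map_inv, topLeft_apply, proj_mk]
    group

end UT

theorem theorem2 (n : ℕ) (hn : 0 < n) :
    classPreservingAut (UT n ℤ) = innerAut (UT n ℤ) := by
  obtain ⟨n, rfl⟩ := Nat.exists_eq_succ_of_ne_zero hn.ne'
  ext φ
  constructor
  · intro h
    obtain ⟨k, hk⟩ := UT.exists_eq_conj_of_isConj φ.toMonoidHom h
    exact ⟨k, MulEquiv.ext fun x => (DFunLike.congr_fun hk x).symm⟩
  · rintro ⟨k, rfl⟩ x
    exact isConj_iff.2 ⟨k, rfl⟩
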